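/- All graphs are finite, simple and undirected. A set $S$ of vertices of a graph $G$ is $P_3$-convex if every vertex of $G$ having at least two neighbours in $S$ belongs to $S$; the $P_3$-hull $\mathcal H(S)$ of a set $S\subseteq V(G)$ is the smallest $P_3$-convex set containing $S$. The $P_3$-Carathéodory number $c(G)$ is the smallest integer $c$ such that for every $S\subseteq V(G)$ and every $p\in\mathcal H(S)$ there is a subset $F\subseteq S$ with $|F|\le c$ and $p\in\mathcal H(F)$. Theorem. Let $n\ge 7$, let $r_1,\dots,r_n\ge 3$ be integers, and let $H_n=K_{r_1}\,\square\,\cdots\,\square\,K_{r_n}$ be the Cartesian product of complete graphs (a Hamming graph). Then \begin{enumerate} \item if $n\equiv 0\pmod 3$, then $c(H_n)=3\cdot 2^{\frac n3-1}$; \item if $n\equiv 1\pmod 3$, then $c(H_n)=4\cdot 2^{\frac{n-1}3-1}$; \item if $n\equiv 2\pmod 3$, then $c(H_n)=5\cdot 2^{\frac{n-2}3-1}$. \end{enumerate} -/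

import Mathlib

namespace SimpleGraph

/-- The Cartesian product of a family of graphs: two vertices are adjacent iff they agree in all
coordinates but one, and in that coordinate they are adjacent in the corresponding factor. -/
def cartesianProduct {ι : Type*} {V : ι → Type*} (G : ∀ i, SimpleGraph (V i)) :
    SimpleGraph (∀ i, V i) where
  Adj x y := ∃ j, (G j).Adj (x j) (y j) ∧ ∀ i, i ≠ j → x i = y i
  symm := ⟨fun _ _ ⟨j, hj, h⟩ => ⟨j, hj.symm, fun i hi => (h i hi).symm⟩⟩
  loopless := ⟨fun _ ⟨j, hj, _⟩ => (G j).loopless.irrefl _ hj⟩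

/-- The Hamming graph `K_{r 0} □ ⋯ □ K_{r (n-1)}`; the vertices of `K_m` are `0, …, m - 1`. -/
def hammingGraph {n : ℕ} (r : Fin n → ℕ) : SimpleGraph (∀ i, Fin (r i)) :=
  cartesianProduct fun i => completeGraph (Fin (r i))

variable {V : Type*}

/-- `S` is `P₃`-convex: the middle vertex of every path `u v w` of length two whose (distinct)
end points lie in `S` belongs to `S`. -/
def P3Convex (G : SimpleGraph V) (S : Set V) : Prop :=
  ∀ ⦃u v w : V⦄, u ∈ S → w ∈ S → u ≠ w → G.Adj u v → G.Adj v w → v ∈ S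

/-- The `P₃`-hull of `S`: the intersection of all `P₃`-convex sets containing `S`. -/
def p3Hull (G : SimpleGraph V) (S : Set V) : Set V :=
  ⋂₀ {C : Set V | G.P3Convex C ∧ S ⊆ C}

/-- `c` is a bound for Carathéodory's property: every vertex in the hull of a set `S` is in the
hull of a subset of `S` with at most `c` elements. -/
def IsP3CaratheodoryBound (G : SimpleGraph V) (c : ℕ) : Prop :=
  ∀ (S : Set V), ∀ p ∈ G.p3Hull S, ∃ F : Finset V, (F : Set V) ⊆ S ∧ F.card ≤ c ∧
    p ∈ G.p3Hull (F : Set V)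

/-- The `P₃`-Carathéodory number: the smallest bound for Carathéodory's property. -/
noncomputable def p3CaratheodoryNumber (G : SimpleGraph V) : ℕ :=
  sInf {c : ℕ | G.IsP3CaratheodoryBound c}

/-- The hull is the least `P₃`-convex set containing `S`. -/
theorem isLeast_p3Hull (G : SimpleGraph V) (S : Set V) :
    IsLeast {C : Set V | G.P3Convex C ∧ S ⊆ C} (G.p3Hull S) :=
  ⟨⟨fun _ _ _ hu hw hne h1 h2 C hC => hC.1 (hu C hC) (hw C hC) hne h1 h2,
    fun _ hx _ hC => hC.2 hx⟩, fun _ hC _ hx => hx _ hC⟩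

/-- In a finite graph the minimum that defines the Carathéodory number is attained. -/
theorem isLeast_p3CaratheodoryNumber [Finite V] (G : SimpleGraph V) :
    IsLeast {c : ℕ | G.IsP3CaratheodoryBound c} G.p3CaratheodoryNumber := by
  have hne : {c : ℕ | G.IsP3CaratheodoryBound c}.Nonempty := by
    refine ⟨Nat.card V, fun S p hp => ⟨S.toFinite.toFinset, by simp, ?_, by simpa using hp⟩⟩
    have := Fintype.ofFinite V
    rw [Nat.card_eq_fintype_card]
    exact Finset.card_le_univ _
  exact ⟨Nat.sInf_mem hne, fun _ hc => Nat.sInf_le hc⟩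

end SimpleGraph

namespace SimpleGraph

/-! ### General facts on `P₃`-hulls. -/

section P3Hull

variable {V : Type*} {G : SimpleGraph V} {S T C : Set V}

/-! Subcubes are convex. If at most two coordinates separate two of them, a convex set containing
both contains the smallest subcube around both (`P3Convex.subcube_union_subset`); if every two of
their vertices differ in three or more coordinates, their union is already convex. Hulls are
therefore governed by merging subcubes. Write `f` for `hammingCaratheodory`.

Upper bound: every hull vertex lies in a subcube of some dimension `k` spanned by at most `f k`
elements of `S`. When a merge gains at least three dimensions over both parts, the two spanning sets
are united, and `2 * f (k - 3) ≤ f k`. Otherwise one part lacks at most two dimensions, and single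
vertices added to its spanning set suffice (`Spans.exists_card_le_union`).

Lower bound: critical sets attaining `f` are built recursively from two smaller sets placed in
slices over a set `A` of directions, with entries `f`, `g` that differ from each other and from the
target `x`; this needs three values per coordinate. Deleting a vertex on one side keeps the two
hulls at distance at least three, so they never merge and no vertex takes the value of `x` on `A`
(`Spans.spansCritically_union`). -/

theorem subset_p3Hull (G : SimpleGraph V) (S : Set V) : S ⊆ G.p3Hull S :=
  (G.isLeast_p3Hull S).1.2

theorem p3Convex_p3Hull (G : SimpleGraph V) (S : Set V) : G.P3Convex (G.p3Hull S) :=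
  (G.isLeast_p3Hull S).1.1

theorem P3Convex.p3Hull_subset (hC : G.P3Convex C) (h : S ⊆ C) : G.p3Hull S ⊆ C :=
  (G.isLeast_p3Hull S).2 ⟨hC, h⟩

theorem p3Hull_mono (h : S ⊆ T) : G.p3Hull S ⊆ G.p3Hull T :=
  (p3Convex_p3Hull G T).p3Hull_subset (h.trans (subset_p3Hull G T))

theorem p3Hull_empty (G : SimpleGraph V) : G.p3Hull ∅ = ∅ :=
  Set.subset_empty_iff.1
    (P3Convex.p3Hull_subset (C := ∅) (fun _ _ _ hu => hu.elim) (Set.Subset.refl _))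

/-- A set `S` all of whose elements are needed to capture `p` bounds the Carathéodory number. -/
theorem card_le_p3CaratheodoryNumber [Finite V] [DecidableEq V] (S : Finset V) {p : V}
    (hp : p ∈ G.p3Hull S) (h : ∀ s ∈ S, p ∉ G.p3Hull (S.erase s : Finset V)) :
    S.card ≤ G.p3CaratheodoryNumber := by
  obtain ⟨F, hFS, hFc, hpF⟩ := (isLeast_p3CaratheodoryNumber G).1 S p hp
  rw [Finset.coe_subset] at hFS
  obtain rfl : F = S := by
    by_contra hne
    obtain ⟨s, hs, hsF⟩ := Finset.exists_of_ssubset (hFS.ssubset_of_ne hne)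
    exact h s hs (p3Hull_mono (Finset.coe_subset.2 (Finset.subset_erase.2 ⟨hFS, hsF⟩)) hpF)
  exact hFc

end P3Hull

/-! ### Subcubes of Hamming graphs: convexity, merging, spanning sets. -/

section Hamming

variable {n : ℕ} {r : Fin n → ℕ}

/-- The coordinates in which `x` and `y` differ. -/
def diffSet (x y : ∀ i, Fin (r i)) : Finset (Fin n) :=
  Finset.univ.filter fun i => x i ≠ y i

/-- The vertices that agree with `x` outside `I`. -/
def subcube (I : Finset (Fin n)) (x : ∀ i, Fin (r i)) : Set (∀ i, Fin (r i)) :=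
  {z | ∀ i, i ∉ I → z i = x i}

@[simp]
theorem mem_diffSet {x y : ∀ i, Fin (r i)} {i : Fin n} : i ∈ diffSet x y ↔ x i ≠ y i := by
  simp [diffSet]

theorem mem_subcube {I : Finset (Fin n)} {x z : ∀ i, Fin (r i)} :
    z ∈ subcube I x ↔ ∀ i, i ∉ I → z i = x i := Iff.rfl

theorem self_mem_subcube (I : Finset (Fin n)) (x : ∀ i, Fin (r i)) : x ∈ subcube I x :=
  fun _ _ => rfl

theorem subcube_mono {I J : Finset (Fin n)} (h : I ⊆ J) (x : ∀ i, Fin (r i)) :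
    subcube I x ⊆ subcube J x :=
  fun _ hz i hi => hz i fun hI => hi (h hI)

theorem subcube_eq_of_mem {I : Finset (Fin n)} {x y : ∀ i, Fin (r i)} (h : y ∈ subcube I x) :
    subcube I y = subcube I x := by
  ext z
  exact forall₂_congr fun i hi => by rw [h i hi]

theorem subcube_empty (x : ∀ i, Fin (r i)) : subcube ∅ x = {x} := by
  ext z
  simp [mem_subcube, funext_iff]

theorem hammingGraph_adj {u v : ∀ i, Fin (r i)} :
    (hammingGraph r).Adj u v ↔ ∃ j, u j ≠ v j ∧ ∀ i, i ≠ j → u i = v i := Iff.rfl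

theorem hammingGraph_adj_update {u : ∀ i, Fin (r i)} {j : Fin n} {c : Fin (r j)} (h : u j ≠ c) :
    (hammingGraph r).Adj u (Function.update u j c) :=
  ⟨j, by simpa using h, fun i hi => by simp [hi]⟩

/-- If the ends agreed in the coordinate changed by the first edge, the second edge would have to
undo that change, forcing `u = w`. -/
theorem exists_ne_of_adj_adj {u v w : ∀ i, Fin (r i)} (huw : u ≠ w)
    (h1 : (hammingGraph r).Adj u v) (h2 : (hammingGraph r).Adj v w) :
    ∃ a, u a ≠ w a ∧ ∀ i, i ≠ a → v i = u i := by
  obtain ⟨a, ha, ha'⟩ := hammingGraph_adj.1 h1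
  obtain ⟨b, hb, hb'⟩ := hammingGraph_adj.1 h2
  refine ⟨a, fun h => huw (funext fun i => ?_), fun i hi => (ha' i hi).symm⟩
  by_cases hi : i = a
  · rw [hi, h]
  · by_cases hib : i = b
    · have hab : a ≠ b := fun e => hi (hib.trans e.symm)
      exact absurd (h.trans (hb' a hab).symm) ha
    · rw [ha' i hi, hb' i hib]

theorem card_diffSet_le_two_of_adj_adj {u v w : ∀ i, Fin (r i)}
    (h1 : (hammingGraph r).Adj u v) (h2 : (hammingGraph r).Adj v w) :
    (diffSet u w).card ≤ 2 := by
  obtain ⟨a, -, ha⟩ := hammingGraph_adj.1 h1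
  obtain ⟨b, -, hb⟩ := hammingGraph_adj.1 h2
  refine (Finset.card_le_card (t := {a, b}) fun i hi => ?_).trans Finset.card_le_two
  by_contra h
  simp only [Finset.mem_insert, Finset.mem_singleton, not_or] at h
  exact mem_diffSet.1 hi ((ha i h.1).trans (hb i h.2))

theorem p3Convex_subcube (I : Finset (Fin n)) (x : ∀ i, Fin (r i)) :
    (hammingGraph r).P3Convex (subcube I x) := by
  intro u v w hu hw huw h1 h2 i hi
  obtain ⟨a, ha, hv⟩ := exists_ne_of_adj_adj huw h1 h2
  by_cases hia : i = a
  · subst hia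
    exact absurd ((hu i hi).trans (hw i hi).symm) ha
  · rw [hv i hia, hu i hi]

theorem P3Convex.union {C D : Set (∀ i, Fin (r i))} (hC : (hammingGraph r).P3Convex C)
    (hD : (hammingGraph r).P3Convex D) (h : ∀ u ∈ C, ∀ w ∈ D, 2 < (diffSet u w).card) :
    (hammingGraph r).P3Convex (C ∪ D) := by
  rintro u v w (hu | hu) (hw | hw) huw h1 h2
  · exact Or.inl (hC hu hw huw h1 h2)
  · exact absurd (card_diffSet_le_two_of_adj_adj h1 h2) (h u hu w hw).not_ge
  · exact absurd (card_diffSet_le_two_of_adj_adj h2.symm h1.symm) (h w hw u hu).not_ge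
  · exact Or.inr (hD hu hw huw h1 h2)

/-- Induction on the distance from `z` to `w`: `z` lies between its projection to the known subcube
and a neighbour one step closer to `w`. -/
theorem P3Convex.subcube_insert_subset {C : Set (∀ i, Fin (r i))}
    (hC : (hammingGraph r).P3Convex C) {I : Finset (Fin n)} {x w : ∀ i, Fin (r i)} {j : Fin n}
    (hI : subcube I x ⊆ C) (hw : w ∈ C) (hj : w j ≠ x j) (hwx : w ∈ subcube (insert j I) x) :
    subcube (insert j I) x ⊆ C := by
  have key : ∀ m, ∀ z ∈ subcube (insert j I) x, (diffSet z w).card = m → z ∈ C := by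
    intro m
    induction m using Nat.strong_induction_on with
    | _ m ih =>
      intro z hz hm
      have proj : ∀ y ∈ subcube (insert j I) x, Function.update y j (x j) ∈ C := by
        intro y hy
        refine hI fun i hi => ?_
        by_cases hij : i = j
        · subst hij; simp
        · simpa [hij] using hy i (by simp [hij, hi])
      by_cases hzj : z j = x j
      · have := proj z hz
        rwa [← hzj, Function.update_eq_self] at this
      by_cases hex : ∃ i, i ≠ j ∧ z i ≠ w i
      · obtain ⟨i, hij, hi⟩ := hex
        have hz' : Function.update z i (w i) ∈ C := by
          refine ih _ ?_ _ ?_ rfl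
          · rw [← hm]
            refine Finset.card_lt_card ⟨fun k hk => ?_, fun hsub => ?_⟩
            · by_cases hki : k = i
              · subst hki; simp at hk
              · simpa [hki] using hk
            · have := hsub (mem_diffSet.2 hi)
              simp at this
          · intro k hk
            by_cases hki : k = i
            · subst hki; simpa using hwx k hk
            · simpa [hki] using hz k hk
        refine hC hz' (proj z hz) (fun e => ?_) (hammingGraph_adj_update hi).symm
          (hammingGraph_adj_update hzj)
        have := congrFun e i
        simp [hij] at this
        exact hi this.symm
      · push Not at hex
        by_cases hzw : z j = w j
        · have : z = w := funext fun i => by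
            by_cases hij : i = j
            · rw [hij, hzw]
            · exact hex i hij
          rwa [this]
        -- Here `z`, `w` and the projection of `w` lie on one line in direction `j`, which is a
        -- clique.
        · refine hC hw (proj w hwx) (fun e => ?_) ⟨j, fun e => hzw e.symm, fun i hi => (hex i hi).symm⟩
            ⟨j, by simpa using hzj, fun i hi => by simp [hi, hex i hi]⟩
          have := congrFun e j
          simp at this
          exact hj this
  exact fun z hz => key _ z hz rfl

theorem P3Convex.subcube_union_diffSet_subset {C : Set (∀ i, Fin (r i))}
    (hC : (hammingGraph r).P3Convex C) {I : Finset (Fin n)} {x w : ∀ i, Fin (r i)}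
    (hI : subcube I x ⊆ C) (hw : w ∈ C) (hd : (diffSet x w \ I).card ≤ 2) :
    subcube (I ∪ diffSet x w) x ⊆ C := by
  have hmem : ∀ i, i ∉ I → x i ≠ w i → i ∈ diffSet x w \ I := fun i h1 h2 => by simp [h1, h2]
  have hU : I ∪ diffSet x w = (diffSet x w \ I) ∪ I := by
    rw [Finset.sdiff_union_self_eq_union, Finset.union_comm]
  rw [hU]
  interval_cases h : (diffSet x w \ I).card
  · rw [Finset.card_eq_zero.1 h]
    simpa using hI
  · obtain ⟨j, hj⟩ := Finset.card_eq_one.1 h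
    have hj' : j ∈ diffSet x w \ I := by simp [hj]
    simp only [Finset.mem_sdiff, mem_diffSet] at hj'
    rw [hj]
    refine hC.subcube_insert_subset hI hw (Ne.symm hj'.1) fun i hi => ?_
    by_contra hne
    simp only [Finset.mem_insert, not_or] at hi
    have := hmem i hi.2 (Ne.symm hne)
    rw [hj, Finset.mem_singleton] at this
    exact hi.1 this
  · obtain ⟨j, l, hjl, hj⟩ := Finset.card_eq_two.1 h
    have hj' : j ∈ diffSet x w \ I := by simp [hj]
    have hl' : l ∈ diffSet x w \ I := by simp [hj]
    simp only [Finset.mem_sdiff, mem_diffSet] at hj' hl'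
    have hwx : ∀ i, i ∉ I → i ≠ j → i ≠ l → w i = x i := by
      intro i hi h1 h2
      by_contra hne
      have := hmem i hi (Ne.symm hne)
      rw [hj] at this
      simp [h1, h2] at this
    -- At distance two, the vertex `u` between `w` and its projection `w'` is captured; it adds
    -- direction `j`, after which `w` itself adds `l`.
    set u := Function.update w l (x l) with hu
    set w' := Function.update u j (x j) with hw'
    have hul : u l = x l := by simp [hu]
    have huj : u j = w j := by simp [hu, hjl]
    have hw'C : w' ∈ C := by
      refine hI fun i hi => ?_
      by_cases h1 : i = j
      · subst h1; simp [hw']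
      · by_cases h2 : i = l
        · subst h2; simp [hw', h1, hul]
        · simpa [hw', hu, h1, h2] using hwx i hi h1 h2
    have huC : u ∈ C := by
      refine hC hw hw'C (fun e => ?_) (hammingGraph_adj_update (Ne.symm hl'.1))
        (hammingGraph_adj_update (by rw [huj]; exact Ne.symm hj'.1))
      have := congrFun e j
      simp [hw'] at this
      exact hj'.1 this.symm
    have h1 : subcube (insert j I) x ⊆ C := by
      refine hC.subcube_insert_subset hI huC (by rw [huj]; exact Ne.symm hj'.1) fun i hi => ?_
      simp only [Finset.mem_insert, not_or] at hi
      by_cases h2 : i = l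
      · rw [h2, hul]
      · simpa [hu, h2] using hwx i hi.2 hi.1 h2
    have h2 : subcube (insert l (insert j I)) x ⊆ C := by
      refine hC.subcube_insert_subset h1 hw (Ne.symm hl'.1) fun i hi => ?_
      simp only [Finset.mem_insert, not_or] at hi
      exact hwx i hi.2.2 hi.2.1 hi.1
    have hEq : diffSet x w \ I ∪ I = insert l (insert j I) := by
      rw [hj]; ext i; simp; tauto
    rwa [hEq]

theorem P3Convex.subcube_union_subset {C : Set (∀ i, Fin (r i))}
    (hC : (hammingGraph r).P3Convex C) (hr : ∀ i, 2 ≤ r i) {I J : Finset (Fin n)}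
    {x y : ∀ i, Fin (r i)} (hI : subcube I x ⊆ C) (hJ : subcube J y ⊆ C)
    (hd : (diffSet x y \ (I ∪ J)).card ≤ 2) :
    subcube (I ∪ J ∪ diffSet x y) x ⊆ C := by
  -- The vertex of the second subcube closest to `x`. Merging with it comes first; the directions of
  -- `J` are then added one by one from `w`.
  set w : ∀ i, Fin (r i) := fun i => if i ∈ J then x i else y i with hw
  have hwJ : w ∈ subcube J y := fun i hi => by simp [hw, hi]
  have hdw : diffSet x w = diffSet x y \ J := by
    ext i
    by_cases hi : i ∈ J <;> simp [hw, hi]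
  have h1 : subcube (I ∪ diffSet x w) x ⊆ C := by
    refine hC.subcube_union_diffSet_subset hI (hJ hwJ) ?_
    rwa [hdw, sdiff_sdiff, Finset.sup_eq_union, Finset.union_comm]
  have hwx : w ∈ subcube (I ∪ diffSet x w) x := by
    intro i hi
    by_contra hne
    exact hi (Finset.mem_union_right _ (mem_diffSet.2 (Ne.symm hne)))
  rw [← subcube_eq_of_mem hwx] at h1
  rw [← subcube_eq_of_mem hwJ] at hJ
  have key : ∀ L ⊆ J, subcube (L ∪ (I ∪ diffSet x w)) w ⊆ C := by
    intro L
    induction L using Finset.induction_on with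
    | empty => intro _; simpa using h1
    | insert j L hjL ih =>
      intro hL
      obtain ⟨c, hc⟩ : ∃ c : Fin (r j), c ≠ w j := by
        have : Nontrivial (Fin (r j)) := Fin.nontrivial_iff_two_le.2 (hr j)
        exact exists_ne _
      rw [Finset.insert_union]
      refine hC.subcube_insert_subset (w := Function.update w j c)
        (ih fun i hi => hL (Finset.mem_insert_of_mem hi)) (hJ fun i hi => ?_) (by simpa using hc)
        fun i hi => ?_
      · have : i ≠ j := fun e => hi (e ▸ hL (Finset.mem_insert_self j L))
        simp [this]
      · have : i ≠ j := fun e => hi (e ▸ Finset.mem_insert_self _ _)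
        simp [this]
  have h2 := key J (Finset.Subset.refl _)
  rw [subcube_eq_of_mem (subcube_mono Finset.subset_union_right x hwx)] at h2
  refine (subcube_mono ?_ x).trans h2
  intro i
  simp only [Finset.mem_union, hdw, Finset.mem_sdiff]
  tauto

/-- The set `T` lies in the subcube at `x` with directions `I` and generates it. -/
def Spans (T : Finset (∀ i, Fin (r i))) (I : Finset (Fin n)) (x : ∀ i, Fin (r i)) : Prop :=
  (T : Set (∀ i, Fin (r i))) ⊆ subcube I x ∧ subcube I x ⊆ (hammingGraph r).p3Hull T

theorem spans_singleton (x : ∀ i, Fin (r i)) : Spans {x} ∅ x := by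
  refine ⟨by simp [subcube_empty], ?_⟩
  rw [subcube_empty, Finset.coe_singleton]
  exact subset_p3Hull _ _

theorem Spans.p3Hull_eq {T : Finset (∀ i, Fin (r i))} {I : Finset (Fin n)} {x : ∀ i, Fin (r i)}
    (h : Spans T I x) : (hammingGraph r).p3Hull T = subcube I x :=
  ((p3Convex_subcube I x).p3Hull_subset h.1).antisymm h.2

theorem Spans.of_mem {T : Finset (∀ i, Fin (r i))} {I : Finset (Fin n)} {x y : ∀ i, Fin (r i)}
    (h : Spans T I x) (hy : y ∈ subcube I x) : Spans T I y := by
  rwa [Spans, subcube_eq_of_mem hy]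

/-- Were `T` constant in coordinate `j`, its hull would stay in a subcube without that direction. -/
theorem Spans.exists_ne {T : Finset (∀ i, Fin (r i))} {I : Finset (Fin n)} {x : ∀ i, Fin (r i)}
    (h : Spans T I x) {j : Fin n} (hj : j ∈ I) (hr : 2 ≤ r j) (c : Fin (r j)) :
    ∃ t ∈ T, t j ≠ c := by
  by_contra! hT
  have : Nontrivial (Fin (r j)) := Fin.nontrivial_iff_two_le.2 hr
  obtain ⟨d, hd⟩ := _root_.exists_ne c
  have hz : Function.update x j d ∈ subcube I x := fun i hi => by
    have : i ≠ j := fun e => hi (e ▸ hj)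
    simp [this]
  have hsub : (hammingGraph r).p3Hull T ⊆ subcube (Finset.univ.erase j) (Function.update x j c) := by
    refine (p3Convex_subcube _ _).p3Hull_subset fun t ht i hi => ?_
    obtain rfl : i = j := by simpa using hi
    simpa using hT t ht
  have := hsub (h.2 hz) j (by simp)
  simp at this
  exact hd this

theorem Spans.union {S T : Finset (∀ i, Fin (r i))} {I J : Finset (Fin n)}
    {x y : ∀ i, Fin (r i)} (hS : Spans S I x) (hT : Spans T J y) (hr : ∀ i, 2 ≤ r i)
    (hd : (diffSet x y \ (I ∪ J)).card ≤ 2) : Spans (S ∪ T) (I ∪ J ∪ diffSet x y) x := by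
  constructor
  · rw [Finset.coe_union]
    refine Set.union_subset (hS.1.trans (subcube_mono (fun i hi => by simp [hi]) x)) ?_
    intro t ht i hi
    simp only [Finset.mem_union, mem_diffSet, not_or, not_not] at hi
    rw [hT.1 ht i hi.1.2, hi.2]
  · exact (p3Convex_p3Hull _ _).subcube_union_subset hr
      (hS.2.trans (p3Hull_mono (by simp))) (hT.2.trans (p3Hull_mono (by simp))) hd

end Hamming

/-- The Carathéodory number of the `n`-dimensional Hamming graphs with factors of order at least
three. -/
def hammingCaratheodory : ℕ → ℕ
  | 0 => 1
  | 1 => 2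
  | 2 => 2
  | 3 => 3
  | 4 => 4
  | 5 => 5
  | n + 6 => 2 * hammingCaratheodory (n + 3)

theorem hammingCaratheodory_add_three {n : ℕ} (h : 3 ≤ n) :
    hammingCaratheodory (n + 3) = 2 * hammingCaratheodory n := by
  obtain ⟨k, rfl⟩ := Nat.exists_eq_add_of_le' h
  rfl

theorem hammingCaratheodory_succ_lt : ∀ n, n ≠ 1 →
    hammingCaratheodory n < hammingCaratheodory (n + 1)
  | 0, _ | 2, _ | 3, _ | 4, _ | 5, _ => by decide
  | n + 6, _ => by
    have := hammingCaratheodory_succ_lt (n + 3) (by omega)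
    change 2 * hammingCaratheodory (n + 3) < 2 * hammingCaratheodory (n + 3 + 1)
    omega

theorem hammingCaratheodory_mono : Monotone hammingCaratheodory := by
  refine monotone_nat_of_le_succ fun n => ?_
  by_cases h : n = 1
  · subst h; decide
  · exact (hammingCaratheodory_succ_lt n h).le

theorem two_mul_hammingCaratheodory_le (n : ℕ) :
    2 * hammingCaratheodory n ≤ hammingCaratheodory (n + 3) := by
  rcases Nat.lt_or_ge n 3 with h | h
  · interval_cases n <;> decide
  · exact (hammingCaratheodory_add_three h).ge

theorem hammingCaratheodory_eq (k : ℕ) :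
    hammingCaratheodory (3 * k + 3) = 3 * 2 ^ k ∧ hammingCaratheodory (3 * k + 4) = 4 * 2 ^ k ∧
      hammingCaratheodory (3 * k + 5) = 5 * 2 ^ k := by
  induction k with
  | zero => decide
  | succ k ih =>
    have h0 := hammingCaratheodory_add_three (n := 3 * k + 3) (by omega)
    have h1 := hammingCaratheodory_add_three (n := 3 * k + 4) (by omega)
    have h2 := hammingCaratheodory_add_three (n := 3 * k + 5) (by omega)
    rw [ih.1] at h0
    rw [ih.2.1] at h1
    rw [ih.2.2] at h2
    refine ⟨h0.trans ?_, h1.trans ?_, h2.trans ?_⟩ <;> ring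

/-! ### Upper bound: economical spanning sets. -/

section Hamming

variable {n : ℕ} {r : Fin n → ℕ}

/-- One further vertex of `S` lies within distance two of the smaller subcube by `hd`, so it merges
at cost one, while `hammingCaratheodory` normally grows with the dimension. -/
theorem Spans.exists_extend {S T : Finset (∀ i, Fin (r i))} {K L : Finset (Fin n)}
    {x : ∀ i, Fin (r i)} (hr : ∀ i, 2 ≤ r i) (hS : Spans S K x) (hT : Spans T L x) (hTS : T ⊆ S)
    (hc : T.card ≤ hammingCaratheodory L.card) (hLK : L ⊆ K) (hne : L ≠ K)
    (hd : (K \ L).card ≤ 2) :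
    ∃ T' L', T' ⊆ S ∧ Spans T' L' x ∧ L ⊂ L' ∧ L' ⊆ K ∧
      T'.card ≤ hammingCaratheodory L'.card := by
  obtain ⟨j, hjK, hjL⟩ := Finset.exists_of_ssubset (hLK.ssubset_of_ne hne)
  obtain ⟨w, hwS, hwj⟩ := hS.exists_ne hjK (hr j) (x j)
  have hwK : diffSet x w ⊆ K := fun i hi => by
    by_contra h
    exact mem_diffSet.1 hi (hS.1 hwS i h).symm
  have hLL : L ⊂ L ∪ diffSet x w := by
    refine Finset.subset_union_left.ssubset_of_ne fun e => hjL ?_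
    rw [e]
    exact Finset.mem_union_right _ (mem_diffSet.2 hwj.symm)
  have hlt := Finset.card_lt_card hLL
  -- The function is constant only from dimension one to two. There `T` is replaced by one of its
  -- vertices that differs from `w` in both directions; these two vertices span the square.
  by_cases h12 : L.card = 1 ∧ (L ∪ diffSet x w).card = 2
  · obtain ⟨a, rfl⟩ := Finset.card_eq_one.1 h12.1
    obtain ⟨t, htT, hta⟩ := hT.exists_ne (Finset.mem_singleton_self a) (hr a) (w a)
    have hD : diffSet t w = {a} ∪ diffSet x w := by
      ext i
      by_cases hi : i = a
      · subst hi; simpa using hta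
      · simp [hi, hT.1 htT i (by simpa using hi)]
    have hspan := (spans_singleton t).union (spans_singleton w) hr (by
      rw [hD]
      exact (Finset.card_le_card Finset.sdiff_subset).trans h12.2.le)
    rw [Finset.empty_union, Finset.empty_union, hD] at hspan
    refine ⟨{t} ∪ {w}, {a} ∪ diffSet x w, ?_, hspan.of_mem fun i hi => ?_, hLL,
      Finset.union_subset hLK hwK, ?_⟩
    · exact Finset.union_subset (by simpa using hTS htT) (by simpa using hwS)
    · exact (hT.1 htT i fun h => hi (Finset.mem_union_left _ h)).symm
    · rw [h12.2]
      exact (Finset.card_union_le _ _).trans (by simp [hammingCaratheodory])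
  · refine ⟨T ∪ {w}, L ∪ diffSet x w, ?_, ?_, hLL, Finset.union_subset hLK hwK, ?_⟩
    · exact Finset.union_subset hTS (by simpa using hwS)
    · have := hT.union (spans_singleton w) hr (by
        rw [Finset.union_empty]
        exact (Finset.card_le_card (Finset.sdiff_subset_sdiff hwK subset_rfl)).trans hd)
      rwa [Finset.union_empty] at this
    · refine (Finset.card_union_le _ _).trans ?_
      rw [Finset.card_singleton]
      by_cases h1 : L.card = 1
      · have : hammingCaratheodory 3 ≤ hammingCaratheodory (L ∪ diffSet x w).card :=
          hammingCaratheodory_mono (by omega)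
        rw [h1] at hc
        simp only [hammingCaratheodory] at this hc
        omega
      · have h2 := hammingCaratheodory_succ_lt _ h1
        have h3 := hammingCaratheodory_mono (Nat.succ_le_of_lt hlt)
        simp only [Nat.succ_eq_add_one] at h3
        omega

theorem Spans.exists_card_le_of_card_sdiff_le {S T : Finset (∀ i, Fin (r i))}
    {K L : Finset (Fin n)} {x : ∀ i, Fin (r i)} (hr : ∀ i, 2 ≤ r i) (hS : Spans S K x)
    (hT : Spans T L x) (hTS : T ⊆ S) (hc : T.card ≤ hammingCaratheodory L.card) (hLK : L ⊆ K)
    (hd : (K \ L).card ≤ 2) :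
    ∃ T' ⊆ S, Spans T' K x ∧ T'.card ≤ hammingCaratheodory K.card := by
  induction hm : (K \ L).card using Nat.strong_induction_on generalizing T L with
  | _ m ih =>
    by_cases hne : L = K
    · subst hne
      exact ⟨T, hTS, hT, hc⟩
    · obtain ⟨T', L', h1, h2, h3, h4, h5⟩ := hS.exists_extend hr hT hTS hc hLK hne hd
      have hlt : (K \ L').card < (K \ L).card := by
        refine Finset.card_lt_card ⟨Finset.sdiff_subset_sdiff subset_rfl h3.1, fun hsub => ?_⟩
        obtain ⟨j, hj', hj⟩ := Finset.exists_of_ssubset h3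
        have := hsub (Finset.mem_sdiff.2 ⟨h4 hj', hj⟩)
        exact (Finset.mem_sdiff.1 this).2 hj'
      exact ih _ (hm ▸ hlt) h2 h1 h5 h4 (hlt.le.trans hd) rfl

theorem Spans.exists_card_le_union {S T : Finset (∀ i, Fin (r i))} {I J : Finset (Fin n)}
    {x y : ∀ i, Fin (r i)} (hr : ∀ i, 2 ≤ r i) (hS : Spans S I x) (hT : Spans T J y)
    (hSc : S.card ≤ hammingCaratheodory I.card) (hTc : T.card ≤ hammingCaratheodory J.card)
    (hd : (diffSet x y \ (I ∪ J)).card ≤ 2) :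
    ∃ F ⊆ S ∪ T, Spans F (I ∪ J ∪ diffSet x y) x ∧
      F.card ≤ hammingCaratheodory (I ∪ J ∪ diffSet x y).card := by
  have hST := hS.union hT hr hd
  set K := I ∪ J ∪ diffSet x y with hK
  have hIK : I ⊆ K := fun i hi => by simp [hK, hi]
  have hJK : J ⊆ K := fun i hi => by simp [hK, hi]
  have hxy : y ∈ subcube K x := fun i hi => by
    by_contra h
    exact hi (Finset.mem_union_right _ (mem_diffSet.2 (Ne.symm h)))
  by_cases h1 : (K \ I).card ≤ 2
  · exact hST.exists_card_le_of_card_sdiff_le hr hS Finset.subset_union_left hSc hIK h1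
  by_cases h2 : (K \ J).card ≤ 2
  · obtain ⟨F, hF, hFs, hFc⟩ := (hST.of_mem hxy).exists_card_le_of_card_sdiff_le hr hT
      Finset.subset_union_right hTc hJK h2
    refine ⟨F, hF, hFs.of_mem ?_, hFc⟩
    rw [subcube_eq_of_mem hxy]
    exact self_mem_subcube _ _
  -- Both `I` and `J` now miss at least three directions of `K`.
  · refine ⟨S ∪ T, subset_rfl, hST, (Finset.card_union_le _ _).trans ?_⟩
    rw [Finset.card_sdiff_of_subset hIK] at h1
    rw [Finset.card_sdiff_of_subset hJK] at h2
    have h3 := two_mul_hammingCaratheodory_le (K.card - 3)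
    rw [Nat.sub_add_cancel (by omega)] at h3
    have h4 : hammingCaratheodory I.card ≤ hammingCaratheodory (K.card - 3) :=
      hammingCaratheodory_mono (by omega)
    have h5 : hammingCaratheodory J.card ≤ hammingCaratheodory (K.card - 3) :=
      hammingCaratheodory_mono (by omega)
    omega

theorem isP3CaratheodoryBound_hammingGraph (hr : ∀ i, 2 ≤ r i) :
    (hammingGraph r).IsP3CaratheodoryBound (hammingCaratheodory n) := by
  intro S p hp
  -- The vertices captured within the budget; convexity of `C` forces it to contain the hull of `S`.
  let C : Set (∀ i, Fin (r i)) := {p | ∃ (F : Finset (∀ i, Fin (r i))) (I : Finset (Fin n))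
    (x : ∀ i, Fin (r i)), (F : Set (∀ i, Fin (r i))) ⊆ S ∧ Spans F I x ∧
      F.card ≤ hammingCaratheodory I.card ∧ p ∈ subcube I x}
  have hC : (hammingGraph r).P3Convex C := by
    rintro u v w ⟨F, I, x, hFS, hF, hFc, hu⟩ ⟨F', J, y, hFS', hF', hFc', hw⟩ huw h1 h2
    -- Outside `I ∪ J` the vertices `u`, `w` copy `x`, `y`, so the path of length two bounds the
    -- separation of the subcubes.
    have hsub : diffSet x y \ (I ∪ J) ⊆ diffSet u w := by
      intro i hi
      simp only [Finset.mem_sdiff, mem_diffSet, Finset.mem_union, not_or] at hi ⊢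
      rw [hu i hi.2.1, hw i hi.2.2]
      exact hi.1
    obtain ⟨E, hE, hEs, hEc⟩ := hF.exists_card_le_union hr hF' hFc hFc'
      ((Finset.card_le_card hsub).trans (card_diffSet_le_two_of_adj_adj h1 h2))
    refine ⟨E, _, x, ?_, hEs, hEc, p3Convex_subcube _ _ (fun i hi => ?_) (fun i hi => ?_)
      huw h1 h2⟩
    · refine (Finset.coe_subset.2 hE).trans ?_
      rw [Finset.coe_union]
      exact Set.union_subset hFS hFS'
    · exact hu i fun h => hi (by simp [h])
    · simp only [Finset.mem_union, mem_diffSet, not_or, not_not] at hi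
      rw [hw i hi.1.2, hi.2]
  have hSC : S ⊆ C := fun s hs => ⟨{s}, ∅, s, by simpa using hs, spans_singleton s,
    by simp [hammingCaratheodory], self_mem_subcube _ _⟩
  obtain ⟨F, I, x, hFS, hF, hFc, hpx⟩ := hC.p3Hull_subset hSC hp
  exact ⟨F, hFS, hFc.trans (hammingCaratheodory_mono (by simpa using Finset.card_le_univ I)),
    hF.2 hpx⟩

end Hamming

/-! ### Lower bound: recursive construction of critical sets. -/

section Hamming

variable {n : ℕ} {r : Fin n → ℕ}

/-- `S` generates the subcube at `x` with directions `K`, but the hull of a subset of `S` with one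
element missing contains no vertex that agrees with `x` in a coordinate from `A`. -/
def SpansCritically (S : Finset (∀ i, Fin (r i))) (K A : Finset (Fin n)) (x : ∀ i, Fin (r i)) :
    Prop :=
  Spans S K x ∧ ∀ s ∈ S, ∀ z ∈ (hammingGraph r).p3Hull (S.erase s : Finset _), ∀ a ∈ A, z a ≠ x a

theorem p3Hull_erase_union_subset {S T : Finset (∀ i, Fin (r i))} {J : Finset (Fin n)}
    {y : ∀ i, Fin (r i)} (hT : Spans T J y) (s : ∀ i, Fin (r i))
    (h : ∀ u ∈ (hammingGraph r).p3Hull (S.erase s : Finset _), ∀ w ∈ subcube J y,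
      2 < (diffSet u w).card) :
    (hammingGraph r).p3Hull ((S ∪ T).erase s : Finset _) ⊆
      (hammingGraph r).p3Hull (S.erase s : Finset _) ∪ subcube J y := by
  refine ((p3Convex_p3Hull _ _).union (p3Convex_subcube J y) h).p3Hull_subset fun t ht => ?_
  simp only [Finset.coe_erase, Finset.coe_union, Set.mem_sdiff, Set.mem_union] at ht
  rcases ht with ⟨ht | ht, hts⟩
  · exact Or.inl (subset_p3Hull _ _ (by simpa using ⟨ht, hts⟩))
  · exact Or.inr (hT.1 ht)

theorem p3Hull_erase_subset {S : Finset (∀ i, Fin (r i))} {I : Finset (Fin n)}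
    {x : ∀ i, Fin (r i)} (hS : Spans S I x) (s : ∀ i, Fin (r i)) :
    (hammingGraph r).p3Hull (S.erase s : Finset _) ⊆ subcube I x :=
  hS.p3Hull_eq ▸ p3Hull_mono (Finset.coe_subset.2 (Finset.erase_subset s S))

/-- The slices differ in all of `A`. After a deletion one hull also avoids `x` on `B`, where the
opposite subcube agrees with `x`, so the distance is at least `B.card + A.card > 2`. The union is
then convex, and its entries on `A` are only those of `f` and `g`. -/
theorem Spans.spansCritically_union {S T : Finset (∀ i, Fin (r i))} {I J A : Finset (Fin n)}
    {x f g : ∀ i, Fin (r i)} (hr : ∀ i, 2 ≤ r i) (hf : ∀ i, f i ≠ x i) (hg : ∀ i, g i ≠ x i)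
    (hfg : ∀ i, f i ≠ g i) (hS : Spans S I (A.piecewise f x)) (hT : Spans T J (A.piecewise g x))
    (hI : Disjoint I A) (hJ : Disjoint J A) (hA : A.card ≤ 2) (hA0 : A.Nonempty)
    (hScrit : ∀ s ∈ S, ∀ z ∈ (hammingGraph r).p3Hull (S.erase s : Finset _),
      ∃ B, Disjoint B J ∧ Disjoint B A ∧ 2 < B.card + A.card ∧ ∀ b ∈ B, z b ≠ x b)
    (hTcrit : ∀ s ∈ T, ∀ z ∈ (hammingGraph r).p3Hull (T.erase s : Finset _),
      ∃ B, Disjoint B I ∧ Disjoint B A ∧ 2 < B.card + A.card ∧ ∀ b ∈ B, z b ≠ x b) :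
    (S ∪ T).card = S.card + T.card ∧ SpansCritically (S ∪ T) (I ∪ J ∪ A) A x := by
  have hD : diffSet (A.piecewise f x) (A.piecewise g x) = A := by
    ext i
    by_cases hi : i ∈ A <;> simp [hi, hfg]
  have hSA : ∀ z ∈ subcube I (A.piecewise f x), ∀ a ∈ A, z a = f a := fun z hz a ha => by
    rw [hz a fun h => Finset.disjoint_left.1 hI h ha, Finset.piecewise_eq_of_mem _ _ _ ha]
  have hTA : ∀ z ∈ subcube J (A.piecewise g x), ∀ a ∈ A, z a = g a := fun z hz a ha => by
    rw [hz a fun h => Finset.disjoint_left.1 hJ h ha, Finset.piecewise_eq_of_mem _ _ _ ha]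
  have hfar : ∀ (L : Finset (Fin n)) (h z w : ∀ i, Fin (r i)), w ∈ subcube L (A.piecewise h x) →
      (∀ a ∈ A, z a ≠ w a) →
      (∃ B, Disjoint B L ∧ Disjoint B A ∧ 2 < B.card + A.card ∧ ∀ b ∈ B, z b ≠ x b) →
      2 < (diffSet z w).card := by
    rintro L h z w hw hzw ⟨B, hBL, hBA, hB, hzB⟩
    rw [← Finset.card_union_of_disjoint hBA] at hB
    refine hB.trans_le (Finset.card_le_card fun i hi => mem_diffSet.2 ?_)
    rcases Finset.mem_union.1 hi with hi | hi
    · rw [hw i (Finset.disjoint_left.1 hBL hi),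
        Finset.piecewise_eq_of_notMem _ _ _ (Finset.disjoint_left.1 hBA hi)]
      exact hzB i hi
    · exact hzw i hi
  have hx : x ∈ subcube (I ∪ J ∪ A) (A.piecewise f x) := fun i hi => by
    rw [Finset.piecewise_eq_of_notMem _ _ _ fun h => hi (Finset.mem_union_right _ h)]
  have hspan := hS.union hT hr (by
    rw [hD]
    exact (Finset.card_le_card Finset.sdiff_subset).trans hA)
  rw [hD] at hspan
  refine ⟨Finset.card_union_of_disjoint (Finset.disjoint_left.2 fun z hz hz' => ?_),
    hspan.of_mem hx, fun s hs z hz a ha => ?_⟩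
  · obtain ⟨a, ha⟩ := hA0
    exact hfg a ((hSA z (hS.1 hz) a ha).symm.trans (hTA z (hT.1 hz') a ha))
  · have hz' : z ∈ subcube I (A.piecewise f x) ∪ subcube J (A.piecewise g x) := by
      rcases Finset.mem_union.1 hs with hs | hs
      · refine Set.union_subset_union_left _ (p3Hull_erase_subset hS s)
          (p3Hull_erase_union_subset hT s (fun u hu w hw => hfar J g u w hw ?_ (hScrit s hs u hu))
            hz)
        intro a ha
        rw [hSA u (p3Hull_erase_subset hS s hu) a ha, hTA w hw a ha]
        exact hfg a
      · rw [Finset.union_comm] at hz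
        rw [Set.union_comm]
        refine Set.union_subset_union_left _ (p3Hull_erase_subset hT s)
          (p3Hull_erase_union_subset hS s (fun u hu w hw => hfar I f u w hw ?_ (hTcrit s hs u hu))
            hz)
        intro a ha
        rw [hTA u (p3Hull_erase_subset hT s hu) a ha, hSA w hw a ha]
        exact (hfg a).symm
    rcases hz' with hz' | hz'
    · rw [hSA z hz' a ha]
      exact hf a
    · rw [hTA z hz' a ha]
      exact hg a

/-- Every subcube of dimension `m` is generated critically, relative to any given `q` of its
directions, by a set of `N` vertices. -/
def HasCriticalSets (r : Fin n → ℕ) (m q N : ℕ) : Prop :=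
  ∀ (K A : Finset (Fin n)) (x : ∀ i, Fin (r i)), K.card = m → A ⊆ K → A.card = q →
    ∃ S : Finset (∀ i, Fin (r i)), S.card = N ∧ SpansCritically S K A x

theorem HasCriticalSets.anti {m q q' N : ℕ} (h : HasCriticalSets r m q N) (hq : q' ≤ q)
    (hqm : q ≤ m) : HasCriticalSets r m q' N := by
  intro K A x hK hAK hA
  obtain ⟨B, hAB, hBK, hB⟩ := Finset.exists_subsuperset_card_eq hAK (hA.trans_le hq)
    (hqm.trans_eq hK.symm)
  obtain ⟨S, hS, hs, hc⟩ := h K B x hK hBK hB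
  exact ⟨S, hS, hs, fun s hs z hz a ha => hc s hs z hz a (hAB ha)⟩

theorem exists_ne_ne_ne (hr : ∀ i, 3 ≤ r i) (x : ∀ i, Fin (r i)) :
    ∃ f g : ∀ i, Fin (r i), (∀ i, f i ≠ x i) ∧ (∀ i, g i ≠ x i) ∧ ∀ i, f i ≠ g i := by
  have h : ∀ i, ∃ a b : Fin (r i), a ≠ x i ∧ b ≠ x i ∧ a ≠ b := by
    intro i
    have hcard : 1 < (Finset.univ.erase (x i)).card := by
      rw [Finset.card_erase_of_mem (Finset.mem_univ _), Finset.card_univ, Fintype.card_fin]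
      have := hr i
      omega
    obtain ⟨a, ha, b, hb, hab⟩ := Finset.one_lt_card.1 hcard
    exact ⟨a, b, Finset.ne_of_mem_erase ha, Finset.ne_of_mem_erase hb, hab⟩
  choose f g hf hg hfg using h
  exact ⟨f, g, hf, hg, hfg⟩

theorem notMem_p3Hull_erase_singleton {s x z : ∀ i, Fin (r i)} (hs : s ∈ ({x} : Finset _)) :
    z ∉ (hammingGraph r).p3Hull (({x} : Finset _).erase s : Finset _) := by
  obtain rfl := Finset.mem_singleton.1 hs
  simp [p3Hull_empty]

theorem hasCriticalSets_one (hr : ∀ i, 3 ≤ r i) : HasCriticalSets r 1 1 2 := by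
  intro K A x hK hAK hA
  obtain rfl := Finset.eq_of_subset_of_card_le hAK (by omega)
  obtain ⟨f, g, hf, hg, hfg⟩ := exists_ne_ne_ne hr x
  have h := (spans_singleton (A.piecewise f x)).spansCritically_union
    (fun i => (by norm_num : 2 ≤ 3).trans (hr i)) hf hg hfg (spans_singleton (A.piecewise g x))
    (Finset.disjoint_empty_left A) (Finset.disjoint_empty_left A) (by omega)
    (Finset.card_pos.1 (by omega))
    (fun s hs z hz => absurd hz (notMem_p3Hull_erase_singleton hs))
    (fun s hs z hz => absurd hz (notMem_p3Hull_erase_singleton hs))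
  rw [Finset.empty_union, Finset.empty_union] at h
  exact ⟨_, h.1, h.2⟩

theorem HasCriticalSets.add_vertex (hr : ∀ i, 3 ≤ r i) {m p q N : ℕ}
    (h : HasCriticalSets r m p N) (hpm : p ≤ m) (hq : 0 < q) (hq2 : q ≤ 2) (hpq : 2 < p + q) :
    HasCriticalSets r (m + q) q (N + 1) := by
  intro K A x hK hAK hA
  obtain ⟨f, g, hf, hg, hfg⟩ := exists_ne_ne_ne hr x
  have hI : (K \ A).card = m := by
    rw [Finset.card_sdiff_of_subset hAK]
    omega
  obtain ⟨B, hB, hBc⟩ := Finset.exists_subset_card_eq (hpm.trans_eq hI.symm)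
  obtain ⟨S, hSc, hS, hcrit⟩ := h (K \ A) B (A.piecewise f x) hI hB hBc
  have hBA : Disjoint B A := Finset.disjoint_of_subset_left hB Finset.sdiff_disjoint
  have h := hS.spansCritically_union (fun i => (by norm_num : 2 ≤ 3).trans (hr i)) hf hg hfg
    (spans_singleton (A.piecewise g x)) Finset.sdiff_disjoint (Finset.disjoint_empty_left A)
    (by omega) (Finset.card_pos.1 (by omega))
    (fun s hs z hz => ⟨B, Finset.disjoint_empty_right B, hBA, by omega, fun b hb => by
      have := hcrit s hs z hz b hb
      rwa [Finset.piecewise_eq_of_notMem _ _ _ (Finset.disjoint_left.1 hBA hb)] at this⟩)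
    (fun s hs z hz => absurd hz (notMem_p3Hull_erase_singleton hs))
  rw [Finset.union_empty, Finset.sdiff_union_of_subset hAK] at h
  exact ⟨_, by rw [h.1, hSc, Finset.card_singleton], h.2⟩

/-- Besides the two directions of `A`, the two subcubes omit one direction each, `b` and `a`. Each
set is critical in the direction omitted by the other, which supplies the third separating
coordinate. -/
theorem HasCriticalSets.double (hr : ∀ i, 3 ≤ r i) {m N : ℕ} (h : HasCriticalSets r m 1 N)
    (hm : 0 < m) : HasCriticalSets r (m + 3) 2 (2 * N) := by
  intro K A x hK hAK hA
  obtain ⟨f, g, hf, hg, hfg⟩ := exists_ne_ne_ne hr x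
  have hc : (K \ A).card = m + 1 := by
    rw [Finset.card_sdiff_of_subset hAK]
    omega
  obtain ⟨a, ha, b, hb, hab⟩ := Finset.one_lt_card.1 (by omega : 1 < (K \ A).card)
  have key : ∀ (c d : Fin n) (φ : ∀ i, Fin (r i)), c ∈ K \ A → d ∈ K \ A → c ≠ d →
      ∃ S : Finset (∀ i, Fin (r i)), S.card = N ∧ Spans S ((K \ A).erase d) (A.piecewise φ x) ∧
        ∀ s ∈ S, ∀ z ∈ (hammingGraph r).p3Hull (S.erase s : Finset _),
          ∃ B, Disjoint B ((K \ A).erase c) ∧ Disjoint B A ∧ 2 < B.card + A.card ∧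
            ∀ b ∈ B, z b ≠ x b := by
    intro c d φ hcK hdK hcd
    obtain ⟨S, hSc, hS, hcrit⟩ := h ((K \ A).erase d) {c} (A.piecewise φ x)
      (by rw [Finset.card_erase_of_mem hdK, hc, Nat.add_sub_cancel])
      (by simpa [hcd] using hcK) (Finset.card_singleton c)
    have hcA : c ∉ A := (Finset.mem_sdiff.1 hcK).2
    refine ⟨S, hSc, hS, fun s hs z hz => ⟨{c}, by simp, by simpa using hcA,
      by rw [hA, Finset.card_singleton]; norm_num, fun e he => ?_⟩⟩
    obtain rfl := Finset.mem_singleton.1 he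
    have := hcrit s hs z hz e he
    rwa [Finset.piecewise_eq_of_notMem _ _ _ hcA] at this
  obtain ⟨S, hSc, hS, hScrit⟩ := key a b f ha hb hab
  obtain ⟨T, hTc, hT, hTcrit⟩ := key b a g hb ha hab.symm
  have h := hS.spansCritically_union (fun i => (by norm_num : 2 ≤ 3).trans (hr i)) hf hg hfg hT
    (Finset.disjoint_of_subset_left (Finset.erase_subset _ _) Finset.sdiff_disjoint)
    (Finset.disjoint_of_subset_left (Finset.erase_subset _ _) Finset.sdiff_disjoint)
    hA.le (Finset.card_pos.1 (by omega)) hScrit hTcrit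
  have hU : (K \ A).erase b ∪ (K \ A).erase a ∪ A = K := by
    ext i
    have h1 : i ∈ A → i ∈ K := fun h => hAK h
    have h2 : i = a → i ≠ b := fun e => e ▸ hab
    simp only [Finset.mem_union, Finset.mem_erase, Finset.mem_sdiff]
    tauto
  rw [hU] at h
  exact ⟨_, by rw [h.1, hSc, hTc, two_mul], h.2⟩

/-- Dimensions arise as `3 = 1 + 2`, `4 = 1 + 3`, `5 = 4 + 1`, then by doubling. For dimension five,
adding a vertex with `q = 1` needs the criticality in two directions that doubling provides. -/
theorem hasCriticalSets (hr : ∀ i, 3 ≤ r i) : ∀ m, 3 ≤ m →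
    HasCriticalSets r m 1 (hammingCaratheodory m)
  | 3, _ => ((hasCriticalSets_one hr).add_vertex hr le_rfl two_pos le_rfl (by norm_num)).anti
      one_le_two (by norm_num)
  | 4, _ => ((hasCriticalSets_one hr).double hr one_pos).anti one_le_two (by norm_num)
  | 5, _ => ((hasCriticalSets_one hr).double hr one_pos).add_vertex hr (by norm_num) one_pos
      one_le_two (by norm_num)
  | m + 6, _ => ((hasCriticalSets hr (m + 3) (by omega)).double hr (by omega)).anti one_le_two
      (by omega)

theorem p3CaratheodoryNumber_hammingGraph (hn : 3 ≤ n) (hr : ∀ i, 3 ≤ r i) :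
    (hammingGraph r).p3CaratheodoryNumber = hammingCaratheodory n := by
  refine le_antisymm ((isLeast_p3CaratheodoryNumber _).2
    (isP3CaratheodoryBound_hammingGraph fun i => (by norm_num : 2 ≤ 3).trans (hr i))) ?_
  let x : ∀ i, Fin (r i) := fun i => ⟨0, by have := hr i; omega⟩
  obtain ⟨S, hSc, hS, hcrit⟩ := hasCriticalSets hr n hn Finset.univ {⟨0, by omega⟩} x
    (Finset.card_fin n) (Finset.subset_univ _) (Finset.card_singleton _)
  rw [← hSc]
  exact card_le_p3CaratheodoryNumber S (hS.2 (self_mem_subcube _ x)) fun s hs hx =>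
    hcrit s hs x hx _ (Finset.mem_singleton_self _) rfl

end Hamming

end SimpleGraph

theorem mainTheorem1 (n : ℕ) (hn : 7 ≤ n) (r : Fin n → ℕ) (hr : ∀ i, 3 ≤ r i) :
    (n % 3 = 0 →
      (SimpleGraph.hammingGraph r).p3CaratheodoryNumber = 3 * 2 ^ (n / 3 - 1)) ∧
    (n % 3 = 1 →
      (SimpleGraph.hammingGraph r).p3CaratheodoryNumber = 4 * 2 ^ ((n - 1) / 3 - 1)) ∧
    (n % 3 = 2 →
      (SimpleGraph.hammingGraph r).p3CaratheodoryNumber = 5 * 2 ^ ((n - 2) / 3 - 1)) := by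
  rw [SimpleGraph.p3CaratheodoryNumber_hammingGraph (by omega) hr]
  refine ⟨fun h => ?_, fun h => ?_, fun h => ?_⟩
  · have := (SimpleGraph.hammingCaratheodory_eq (n / 3 - 1)).1
    rwa [show 3 * (n / 3 - 1) + 3 = n by omega] at this
  · have := (SimpleGraph.hammingCaratheodory_eq ((n - 1) / 3 - 1)).2.1
    rwa [show 3 * ((n - 1) / 3 - 1) + 4 = n by omega] at this
  · have := (SimpleGraph.hammingCaratheodory_eq ((n - 2) / 3 - 1)).2.2
    rwa [show 3 * ((n - 2) / 3 - 1) + 5 = n by omega] at this
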